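/- **Theorem ($\ell_2$-consistency of moment least squares estimators).** Let $S$ be a Polish space with its Borel $\sigma$-algebra, $Q$ a Markov transition kernel on $S$, and $\pi,\psi$ probability measures on $S$, such that: - (reversibility) $\int_A Q(x,B)\,\pi(dx)=\int_B Q(x,A)\,\pi(dx)$ for all measurable $A,B$; - ($\psi$-irreducibility) for every measurable $A$ with $\psi(A)>0$ and every $x\in S$ there is a $t$ with $Q^t(x,A)>0$; - (geometric drift) there are a small set $C$, constants $\beta>0$, $b<\infty$ and a measurable $V:S\to[1,\infty)$ with $QV(x)-V(x)\le-\beta V(x)+b\,1_C(x)$ for all $x$, where $QV(x)=\int V(y)\,Q(x,dy)<\infty$; a measurable $C$ is *small* if for some $m\ge1$ and some nonzero measure $\nu$ one has $Q^m(x,B)\ge\nu(B)$ for all $x\in C$ and all measurable $B$; - (aperiodicity) there are no $d\ge2$ and pairwise disjoint measurable $D_0,\dots,D_{d-1}$ with $Q(x,D_{i+1 \bmod d})=1$ for all $x\in D_i$ and all $i$, and $\psi\big((\bigcup_iD_i)^c\big)=0$. Let $X_0,X_1,\dots$ be a Markov chain with transition kernel $Q$ (and arbitrary initial law) on a probability space,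 and let $g:S\to\mathbb R$ be in $L^2(\pi)$. Let $\gamma(k)=\mathrm{Cov}(g(Y_0),g(Y_{|k|}))$, $k\in\mathbb Z$, where $(Y_0,Y_{|k|})\sim\pi(dx)\,Q^{|k|}(x,dy)$, be the autocovariance sequence of the stationary chain. There is exactly one finite, compactly supported Borel measure $F$ on $\mathbb R$ with $\gamma(k)=\int x^{|k|}F(dx)$ for all $k\in\mathbb Z$, the representing measure of $\gamma$. Let $\delta>0$ be such that $F$ is supported on $[-1+\delta,1-\delta]$. Let $r_M$, $M\ge1$, be estimators, where $r_M=(r_M(k))_{k\in\mathbb Z}$ is a function of the sample $(X_0,\dots,X_{M-1})$, such that: - (R.1) for each $k\in\mathbb Z$, $r_M(k)\to\gamma(k)$ almost surely as $M\to\infty$; - (R.2) for each $M\geq 1$ and each sample there is $n<\infty$ with $r_M(k)=0$ for all $k\ge n$; - (R.3) $r_M(k)=r_M(-k)$ and $r_M(0)\ge|r_M(k)|$ for all $k\in\mathbb Z$, $M\geq 1$ and all samples. Let $\mathscr M_\delta$ be the set of sequences $m\in\ell_2(\mathbb Z)$ such that $m(k)=\int x^{|k|}\mu(dx)$ for all $k\in\mathbb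 Z$, for some finite Borel measure $\mu$ on $\mathbb R$ supported on $[-1+\delta,1-\delta]$. Then $\gamma\in\ell_2(\mathbb Z)$; for every $M\ge1$ and every sample, $r_M\in\ell_2(\mathbb Z)$ and the projection $\Pi_\delta(r_M)=\arg\min_{m\in\mathscr M_\delta}\sum_{k\in\mathbb Z}(r_M(k)-m(k))^2$ exists and is unique; and $$\|\gamma-\Pi_\delta(r_M)\|^2=\sum_{k\in\mathbb Z}\big(\gamma(k)-\Pi_\delta(r_M)(k)\big)^2\longrightarrow0\quad\text{almost surely as }M\to\infty .$$ -/

import Mathlib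

open MeasureTheory ProbabilityTheory Filter Topology Set
open scoped ENNReal

namespace MomentLS

section Chain

variable {S : Type*} [MeasurableSpace S]

/-- `C` is a small set for `Q`: for some `m ≥ 1` and some nontrivial measure `ν`,
`Q^m(x, B) ≥ ν(B)` for all `x ∈ C` and all measurable `B`. -/
def IsSmallSet (Q : Kernel S S) (C : Set S) : Prop :=
  MeasurableSet C ∧ ∃ m : ℕ, 1 ≤ m ∧ ∃ ν : Measure S, ν ≠ 0 ∧
    ∀ x ∈ C, ∀ B, MeasurableSet B → ν B ≤ (Q ^ m) x B

/-- The geometric drift condition `QV - V ≤ -β V + b 1_C`, with `C` small and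
`V : S → [1, ∞)`.  The integrability of `V` says that `QV` is finite, as the inequality requires. -/
def GeometricDrift (Q : Kernel S S) : Prop :=
  ∃ (C : Set S) (β b : ℝ) (V : S → ℝ), IsSmallSet Q C ∧ 0 < β ∧ Measurable V ∧ (∀ x, 1 ≤ V x) ∧
    (∀ x, Integrable V (Q x)) ∧
    ∀ x, (∫ y, V y ∂(Q x)) - V x ≤ -β * V x + b * C.indicator 1 x

/-- Aperiodicity of a `ψ`-irreducible kernel `Q`: there is no cycle of length `d ≥ 2`, that is, no
disjoint measurable sets `D 0, …, D (d-1)` that cover the space up to a `ψ`-null set and satisfy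
`Q(x, D (i+1 mod d)) = 1` for `x ∈ D i`. -/
def IsAperiodic (ψ : Measure S) (Q : Kernel S S) : Prop :=
  ¬ ∃ (d : ℕ) (D : ZMod d → Set S), 2 ≤ d ∧ (∀ i, MeasurableSet (D i)) ∧
    Pairwise (fun i j => Disjoint (D i) (D j)) ∧
    (∀ i, ∀ x ∈ D i, Q x (D (i + 1)) = 1) ∧
    ψ (⋃ i, D i)ᶜ = 0

/-- `X 0, X 1, …` is a Markov chain with transition kernel `Q` under `P` (with an arbitrary initial
law): `P(X (n+1) ∈ A | X 0, …, X n) = Q(X n, A)` almost surely. -/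
def IsMarkovChain {Ω : Type*} [MeasurableSpace Ω] (P : Measure Ω) (Q : Kernel S S)
    (X : ℕ → Ω → S) : Prop :=
  (∀ n, Measurable (X n)) ∧
    ∀ (n : ℕ) (A : Set S), MeasurableSet A →
      P⟦X (n + 1) ⁻¹' A |
        MeasurableSpace.comap (fun ω (i : Fin (n + 1)) => X i ω) MeasurableSpace.pi⟧
        =ᵐ[P] fun ω => (Q (X n ω)).real A

/-- The autocovariance sequence `γ(k) = Cov(g(X_0), g(X_|k|))` of the stationary chain: the pair
`(X_0, X_|k|)` has law `π(dx) Q^|k|(x, dy)`. -/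
noncomputable def autocov (Q : Kernel S S) (π : Measure S) (g : S → ℝ) (k : ℤ) : ℝ :=
  cov[fun z : S × S => g z.1, fun z : S × S => g z.2; π ⊗ₘ (Q ^ k.natAbs)]

/-- The conditions on an initial estimator `r` of the sequence `γ`. Here `r M x k` is the value at
lag `k` of the estimator computed from the sample `x` of size `M`. -/
structure IsInitialEstimator {Ω : Type*} [MeasurableSpace Ω] (P : Measure Ω) (X : ℕ → Ω → S)
    (γ : ℤ → ℝ) (r : (M : ℕ) → (Fin M → S) → ℤ → ℝ) : Prop where
  tendsto : ∀ k, ∀ᵐ ω ∂P, Tendsto (fun M => r M (fun i => X i ω) k) atTop (𝓝 (γ k))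
  finite_support : ∀ M, 1 ≤ M → ∀ x, ∃ n : ℕ, ∀ k : ℤ, (n : ℤ) ≤ k → r M x k = 0
  even : ∀ M, 1 ≤ M → ∀ x k, r M x (-k) = r M x k
  peak : ∀ M, 1 ≤ M → ∀ x k, |r M x k| ≤ r M x 0

end Chain

section Moment

/-- `F` is a representing measure of `m`, carried by `[a, b]`:
`F` is a finite measure with `F(ℝ \ [a, b]) = 0` and `m(k) = ∫ x^|k| F(dx)` for all `k`. -/
def RepresentsOn (a b : ℝ) (F : Measure ℝ) (m : ℤ → ℝ) : Prop :=
  IsFiniteMeasure F ∧ F (Icc a b)ᶜ = 0 ∧ ∀ k, m k = ∫ x, x ^ k.natAbs ∂F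

/-- `F` is a representing measure of `m`, carried by some compact interval. -/
def IsRepresentingMeasure (F : Measure ℝ) (m : ℤ → ℝ) : Prop :=
  ∃ a b : ℝ, RepresentsOn a b F m

/-- The sequences in `ℓ²(ℤ)` that are moment sequences of a measure on `[-1 + δ, 1 - δ]`. -/
def momentSet (δ : ℝ) : Set (ℤ → ℝ) :=
  {m | (∃ F, RepresentsOn (-1 + δ) (1 - δ) F m) ∧ Memℓp m 2}

/-- The squared `ℓ²(ℤ)` distance of two sequences (in `ℓ²(ℤ)`). -/
noncomputable def sqDist (p q : ℤ → ℝ) : ℝ := ∑' k, (p k - q k) ^ 2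

/-- `p` is a minimizer of `‖r - m‖²` over `m ∈ momentSet δ`. -/
def IsMomentLSE (δ : ℝ) (r p : ℤ → ℝ) : Prop :=
  p ∈ momentSet δ ∧ ∀ m ∈ momentSet δ, sqDist r p ≤ sqDist r m

/-- The projection `Π_δ(r)` of `r ∈ ℓ²(ℤ)`: the minimizer of `‖r - m‖²` over `momentSet δ`. -/
noncomputable def momentLSE (δ : ℝ) (r : ℤ → ℝ) : ℤ → ℝ := Classical.epsilon (IsMomentLSE δ r)

end Moment

end MomentLS

namespace MomentLS

/-! Reversibility makes `Q` a self-adjoint contraction `T` on `L²(π)`, and `γ(k) = ⟨v, T^|k| v⟩`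
with `v` the centred `g`. Polynomials nonnegative on `[-1, 1]` then give nonnegative values of the
moment functional, so Hausdorff's theorem (`exists_representsOn_iff`) yields a representing measure;
Weierstrass gives uniqueness.

The rest is Hilbert space geometry. Moment sequences on `[-1 + δ, 1 - δ]` form a closed convex cone
in `ℓ²`, so the projection `p` of `r` exists, and its variational inequality gives `‖γ - p‖² ≤ ⟨γ -
r, γ - p⟩`. Only pointwise convergence of `r` is known, but `γ - p` decays geometrically, at a rate
fixed by `δ` and with a constant controlled by the masses `γ(0)` and `p(0)`. Orthogonality `⟨p, p⟩ =
⟨r, p⟩` bounds `p(0)` by a multiple of `r(0)` (`IsMomentLSE.zero_le`), and dominated convergence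
finishes. -/

/-! ### The Hausdorff moment problem on a compact interval -/

open Polynomial in
/-- The linear functional on polynomials that sends `x ^ n` to `m n`. -/
noncomputable def momentFunctional (m : ℤ → ℝ) : ℝ[X] →ₗ[ℝ] ℝ :=
  Polynomial.lsum fun n => m n • LinearMap.id

lemma momentFunctional_apply (m : ℤ → ℝ) (p : Polynomial ℝ) :
    momentFunctional m p = p.sum fun n c => m n * c := by
  simp [momentFunctional, Polynomial.lsum_apply]

lemma momentFunctional_X_pow (m : ℤ → ℝ) (n : ℕ) :
    momentFunctional m (Polynomial.X ^ n) = m n := by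
  rw [momentFunctional_apply, Polynomial.X_pow_eq_monomial, Polynomial.sum_monomial_index] <;> simp

lemma momentFunctional_add (m m' : ℤ → ℝ) (p : Polynomial ℝ) :
    momentFunctional (m + m') p = momentFunctional m p + momentFunctional m' p := by
  simp [momentFunctional_apply, Polynomial.sum, add_mul, Finset.sum_add_distrib]

lemma momentFunctional_smul (c : ℝ) (m : ℤ → ℝ) (p : Polynomial ℝ) :
    momentFunctional (c • m) p = c * momentFunctional m p := by
  simp [momentFunctional_apply, Polynomial.sum, Finset.mul_sum, mul_assoc]

lemma momentFunctional_zero (p : Polynomial ℝ) : momentFunctional 0 p = 0 := by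
  simpa using momentFunctional_smul 0 0 p

lemma continuous_momentFunctional (p : Polynomial ℝ) :
    Continuous fun m : ℤ → ℝ => momentFunctional m p := by
  simp only [momentFunctional_apply, Polynomial.sum]
  fun_prop

open CompactlySupported in
/-- A positive linear functional on `C(X, ℝ)`, `X` compact, is integration against a finite
measure. -/
lemma exists_measure_of_nonneg {X : Type*} [TopologicalSpace X] [T2Space X] [CompactSpace X]
    [MeasurableSpace X] [BorelSpace X] (Λ : C(X, ℝ) →ₗ[ℝ] ℝ) (hΛ : ∀ f, 0 ≤ f → 0 ≤ Λ f) :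
    ∃ μ : Measure X, IsFiniteMeasure μ ∧ ∀ f : C(X, ℝ), ∫ x, f x ∂μ = Λ f := by
  -- On a compact space every continuous function has compact support, so Riesz–Markov–Kakutani
  -- applies.
  let l : C_c(X, ℝ) →ₗ[ℝ] ℝ :=
    { toFun := fun f => Λ f.toContinuousMap
      map_add' := fun f g => Λ.map_add _ _
      map_smul' := fun c f => Λ.map_smul c _ }
  let Λ' : C_c(X, ℝ) →ₚ[ℝ] ℝ := PositiveLinearMap.mk₀ l fun f hf => hΛ _ fun x => hf x
  refine ⟨RealRMK.rieszMeasure Λ', ⟨?_⟩, fun f => ?_⟩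
  · rw [RealRMK.rieszMeasure]
    exact isCompact_univ.measure_lt_top
  · exact RealRMK.integral_rieszMeasure Λ' (CompactlySupportedContinuousMap.continuousMapEquiv f)

/-- A linear functional on polynomials that is nonnegative on the polynomials nonnegative on
`[a, b]` extends to a positive functional on `C([a, b])`. -/
lemma exists_positive_extension (a b : ℝ) (l : Polynomial ℝ →ₗ[ℝ] ℝ)
    (hl : ∀ p : Polynomial ℝ, (∀ x ∈ Icc a b, 0 ≤ p.eval x) → 0 ≤ l p) :
    ∃ Λ : C(Icc a b, ℝ) →ₗ[ℝ] ℝ, (∀ f, 0 ≤ f → 0 ≤ Λ f) ∧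
      ∀ p : Polynomial ℝ, Λ (p.toContinuousMapOn (Icc a b)) = l p := by
  -- M. Riesz extension on the product, with the cone of pairs whose sum is nonnegative on `[a, b]`:
  -- restriction of polynomials to `[a, b]` need not be injective, so `l` is not transported to a
  -- subspace of `C([a, b])`.
  let s : PointedCone ℝ (Polynomial ℝ × C(Icc a b, ℝ)) :=
    { carrier := {z | ∀ x : Icc a b, 0 ≤ z.1.eval (x : ℝ) + z.2 x}
      add_mem' := fun {y z} hy hz x => by
        have := add_nonneg (hy x) (hz x)
        simp only [Prod.fst_add, Prod.snd_add, Polynomial.eval_add, ContinuousMap.add_apply]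
        linarith
      zero_mem' := fun x => by simp
      smul_mem' := fun c z hz x => by
        have := mul_nonneg c.2 (hz x)
        rw [mul_add] at this
        change 0 ≤ ((c : ℝ) • z.1).eval (x : ℝ) + ((c : ℝ) • z.2) x
        rw [Polynomial.eval_smul, ContinuousMap.smul_apply]
        exact this }
  let f : Polynomial ℝ × C(Icc a b, ℝ) →ₗ.[ℝ] ℝ :=
    { domain := Submodule.prod ⊤ ⊥
      toFun := l ∘ₗ LinearMap.fst ℝ _ _ ∘ₗ Submodule.subtype _ }
  obtain ⟨g, hg, hpos⟩ := riesz_extension s f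
    (fun z hz => hl _ fun x hx => by
      have h := hz ⟨x, hx⟩
      have h2 : (z : Polynomial ℝ × C(Icc a b, ℝ)).2 = 0 := by
        simpa using z.2.2
      simpa [h2] using h)
    (fun y => by
      -- A large constant polynomial moves any pair into the cone.
      obtain ⟨c, hc⟩ : ∃ c : ℝ, ∀ x, -(y.1.toContinuousMapOn (Icc a b) + y.2) x ≤ c := by
        refine ⟨‖y.1.toContinuousMapOn (Icc a b) + y.2‖, fun x => ?_⟩
        exact (neg_le_abs _).trans
          (ContinuousMap.norm_coe_le_norm (y.1.toContinuousMapOn (Icc a b) + y.2) x)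
      refine ⟨⟨(Polynomial.C c, 0), by simp [f, Submodule.mem_prod]⟩, fun x => ?_⟩
      have := hc x
      simp only [ContinuousMap.add_apply, Polynomial.toContinuousMapOn_apply,
        Polynomial.toContinuousMap_apply] at this
      simp
      linarith)
  refine ⟨g ∘ₗ LinearMap.inr ℝ _ _, fun h hh => hpos _ fun x => ?_, fun p => ?_⟩
  · simpa using hh x
  · have h1 : g (p, 0) = l p := hg ⟨(p, 0), by simp [f, Submodule.mem_prod]⟩
    -- The pair and its negative both lie in the cone, which forces `g (0, p) = g (p, 0)`.
    have h2 : 0 ≤ g (p, -p.toContinuousMapOn (Icc a b)) := hpos _ fun x => by simp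
    have h3 : 0 ≤ g (-p, p.toContinuousMapOn (Icc a b)) := hpos _ fun x => by simp
    have h4 : g (p, -p.toContinuousMapOn (Icc a b)) =
        g (p, 0) - g (0, p.toContinuousMapOn (Icc a b)) := by
      rw [← map_sub]; simp
    have h5 : g (-p, p.toContinuousMapOn (Icc a b)) =
        g (0, p.toContinuousMapOn (Icc a b)) - g (p, 0) := by
      rw [← map_sub]; simp
    simp only [LinearMap.comp_apply, LinearMap.inr_apply]
    linarith

/-- Continuous functions are integrable for a finite measure carried by a compact interval. -/
lemma integrable_of_continuous {a b : ℝ} {F : Measure ℝ} [IsFiniteMeasure F]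
    (hF : F (Icc a b)ᶜ = 0) {f : ℝ → ℝ} (hf : Continuous f) : Integrable f F := by
  have : F.restrict (Icc a b) = F := Measure.restrict_eq_self_of_ae_mem (by
    rw [ae_iff]; exact hF)
  rw [← this]
  exact (hf.continuousOn.integrableOn_compact isCompact_Icc)

lemma RepresentsOn.momentFunctional_eq {a b : ℝ} {F : Measure ℝ} {m : ℤ → ℝ}
    (h : RepresentsOn a b F m) (p : Polynomial ℝ) :
    momentFunctional m p = ∫ x, p.eval x ∂F := by
  obtain ⟨hfin, hF, hm⟩ := h
  simp only [Polynomial.eval_eq_sum, Polynomial.sum]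
  rw [integral_finsetSum _ fun n _ => integrable_of_continuous hF (by fun_prop),
    momentFunctional_apply, Polynomial.sum]
  refine Finset.sum_congr rfl fun n _ => ?_
  rw [integral_const_mul, hm]
  simp [mul_comm]

/-- Solution of the moment problem on `[a, b]` (Hausdorff). -/
lemma exists_representsOn_iff {a b : ℝ} {m : ℤ → ℝ} :
    (∃ F, RepresentsOn a b F m) ↔ (∀ k : ℤ, m k = m k.natAbs) ∧
      ∀ p : Polynomial ℝ, (∀ x ∈ Icc a b, 0 ≤ p.eval x) → 0 ≤ momentFunctional m p := by
  constructor
  · rintro ⟨F, hF⟩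
    refine ⟨fun k => by rw [hF.2.2, hF.2.2, Int.natAbs_natCast], fun p hp => ?_⟩
    rw [hF.momentFunctional_eq]
    refine integral_nonneg_of_ae ?_
    have : ∀ᵐ x ∂F, x ∈ Icc a b := by rw [ae_iff]; exact hF.2.1
    filter_upwards [this] with x hx using hp x hx
  · rintro ⟨heven, hpos⟩
    obtain ⟨Λ, hΛ, hΛp⟩ := exists_positive_extension a b _ hpos
    obtain ⟨μ, hμ, hint⟩ := exists_measure_of_nonneg Λ hΛ
    refine ⟨μ.map Subtype.val, inferInstance, ?_, fun k => ?_⟩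
    · rw [Measure.map_apply measurable_subtype_coe measurableSet_Icc.compl]
      simp
    · rw [integral_map measurable_subtype_coe.aemeasurable (by fun_prop), heven,
        ← momentFunctional_X_pow m, ← hΛp, ← hint]
      simp

/-- A finite measure carried by a compact interval is determined by its moments. -/
lemma IsRepresentingMeasure.unique {F G : Measure ℝ} {m : ℤ → ℝ} (hF : IsRepresentingMeasure F m)
    (hG : IsRepresentingMeasure G m) : F = G := by
  obtain ⟨a, b, hF⟩ := hF
  obtain ⟨c, d, hG⟩ := hG
  have wide : ∀ {a' b' : ℝ} {H : Measure ℝ}, RepresentsOn a' b' H m → min a c ≤ a' →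
      b' ≤ max b d → RepresentsOn (min a c) (max b d) H m := fun h h1 h2 =>
    ⟨h.1, measure_mono_null (compl_subset_compl.2 (Icc_subset_Icc h1 h2)) h.2.1, h.2.2⟩
  replace hF := wide hF (min_le_left _ _) (le_max_left _ _)
  replace hG := wide hG (min_le_right _ _) (le_max_right _ _)
  generalize min a c = a at *
  generalize max b d = b at *
  have := hF.1
  have := hG.1
  refine ext_of_forall_integral_eq_of_IsFiniteMeasure fun f => ?_
  refine eq_of_abs_sub_le_all fun ε hε => ?_
  -- The `+ 1` keeps the denominator positive when both measures vanish.
  have hC : 0 < F.real univ + G.real univ + 1 := by positivity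
  obtain ⟨p, hp⟩ := exists_polynomial_near_of_continuousOn a b f f.continuous.continuousOn
    (ε / (F.real univ + G.real univ + 1)) (by positivity)
  have key : ∀ {H : Measure ℝ}, RepresentsOn a b H m →
      |∫ x, f x ∂H - momentFunctional m p| ≤
        ε / (F.real univ + G.real univ + 1) * H.real univ := fun {H} hH => by
    have := hH.1
    rw [hH.momentFunctional_eq, ← integral_sub (f.integrable H)
      (integrable_of_continuous hH.2.1 p.continuous)]
    rw [← Real.norm_eq_abs]
    refine norm_integral_le_of_norm_le_const ?_
    have : ∀ᵐ x ∂H, x ∈ Icc a b := by rw [ae_iff]; exact hH.2.1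
    filter_upwards [this] with x hx
    rw [Real.norm_eq_abs, abs_sub_comm]
    exact (hp x hx).le
  have h1 := key hF
  have h2 := key hG
  rw [abs_sub_comm] at h2
  calc _ ≤ _ := abs_sub_le _ (momentFunctional m p) _
    _ ≤ ε / (F.real univ + G.real univ + 1) * F.real univ +
        ε / (F.real univ + G.real univ + 1) * G.real univ := add_le_add h1 h2
    _ = ε * ((F.real univ + G.real univ) / (F.real univ + G.real univ + 1)) := by ring
    _ ≤ ε * 1 := by
      gcongr
      rw [div_le_one hC]; linarith
    _ = ε := mul_one _

/-! ### Geometric decay and square summability -/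

lemma summable_pow_natAbs {ρ : ℝ} (h0 : 0 ≤ ρ) (h1 : ρ < 1) :
    Summable fun k : ℤ => ρ ^ k.natAbs := by
  refine Summable.of_nat_of_neg ?_ ?_ <;> simpa using summable_geometric_of_lt_one h0 h1

lemma RepresentsOn.zero_eq {a b : ℝ} {F : Measure ℝ} {m : ℤ → ℝ} (h : RepresentsOn a b F m) :
    m 0 = F.real univ := by
  simp [h.2.2]

/-- On the support `|x| ≤ 1 - δ`, and `m 0` is the total mass. The `max` keeps the ratio nonnegative
when `δ > 1`, where the interval is empty. -/
lemma RepresentsOn.abs_le {δ : ℝ} {F : Measure ℝ} {m : ℤ → ℝ}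
    (h : RepresentsOn (-1 + δ) (1 - δ) F m) (k : ℤ) :
    |m k| ≤ m 0 * max (1 - δ) 0 ^ k.natAbs := by
  have := h.1
  rw [h.zero_eq, h.2.2, ← Real.norm_eq_abs, mul_comm]
  refine norm_integral_le_of_norm_le_const ?_
  have : ∀ᵐ x ∂F, x ∈ Icc (-1 + δ) (1 - δ) := by rw [ae_iff]; exact h.2.1
  filter_upwards [this] with x hx
  rw [norm_pow]
  refine pow_le_pow_left₀ (norm_nonneg x) ((_root_.abs_le.2 ⟨?_, hx.2⟩).trans (le_max_left _ _)) _
  linarith [hx.1]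

lemma memℓp_two_of_abs_le {m : ℤ → ℝ} {B ρ : ℝ} (h0 : 0 ≤ ρ) (h1 : ρ < 1)
    (h : ∀ k, |m k| ≤ B * ρ ^ k.natAbs) : Memℓp m 2 := by
  refine memℓp_gen ?_
  have hs := (summable_pow_natAbs (sq_nonneg ρ) (by nlinarith : ρ ^ 2 < 1)).mul_left (B ^ 2)
  refine hs.of_nonneg_of_le (fun k => by positivity) fun k => ?_
  have := pow_le_pow_left₀ (abs_nonneg _) (h k) 2
  rw [mul_pow, ← pow_mul, mul_comm k.natAbs, pow_mul] at this
  simpa using this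

lemma RepresentsOn.memℓp {δ : ℝ} (hδ : 0 < δ) {F : Measure ℝ} {m : ℤ → ℝ}
    (h : RepresentsOn (-1 + δ) (1 - δ) F m) : Memℓp m 2 :=
  memℓp_two_of_abs_le (le_max_right _ _) (max_lt (by linarith) one_pos) h.abs_le

lemma exists_lp_eq {m : ℤ → ℝ} (hm : Memℓp m 2) : ∃ u : lp (fun _ : ℤ => ℝ) 2, u = m :=
  ⟨⟨m, hm⟩, rfl⟩

lemma memℓp_two_of_finite_support {m : ℤ → ℝ} (heven : ∀ k, m (-k) = m k) {n : ℕ}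
    (h : ∀ k : ℤ, (n : ℤ) ≤ k → m k = 0) : Memℓp m 2 := by
  refine (memℓp_zero ((Set.finite_Icc (-(n : ℤ)) n).subset fun k hk => ?_)).of_exponent_ge
    zero_le
  by_contra hk'
  rw [Set.mem_Icc, not_and_or, not_le, not_le] at hk'
  refine hk ?_
  rcases hk' with hk' | hk'
  · rw [← heven]; exact h _ (by omega)
  · exact h _ hk'.le

/-! ### The cone of moment sequences and its projection -/

/-- The elements of `ℓ²(ℤ)` whose sequences lie in `momentSet δ`. -/
def momentCone (δ : ℝ) : Set (lp (fun _ : ℤ => ℝ) 2) := {u | (u : ℤ → ℝ) ∈ momentSet δ}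

/-- Each condition on the right is linear and involves finitely many coordinates, so convexity and
closedness follow without taking limits of measures. -/
lemma mem_momentCone_iff {δ : ℝ} {u : lp (fun _ : ℤ => ℝ) 2} :
    u ∈ momentCone δ ↔ (∀ k : ℤ, u k = u k.natAbs) ∧ ∀ p : Polynomial ℝ,
      (∀ x ∈ Icc (-1 + δ) (1 - δ), 0 ≤ p.eval x) → 0 ≤ momentFunctional u p := by
  rw [← exists_representsOn_iff]
  exact ⟨fun h => h.1, fun h => ⟨h, lp.memℓp u⟩⟩

lemma zero_mem_momentCone (δ : ℝ) : (0 : lp (fun _ : ℤ => ℝ) 2) ∈ momentCone δ :=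
  mem_momentCone_iff.2 ⟨fun k => by simp, fun p _ => (momentFunctional_zero p).ge⟩

lemma smul_mem_momentCone {δ c : ℝ} (hc : 0 ≤ c) {u : lp (fun _ : ℤ => ℝ) 2}
    (hu : u ∈ momentCone δ) : c • u ∈ momentCone δ := by
  rw [mem_momentCone_iff] at *
  refine ⟨fun k => ?_, fun p hp => ?_⟩
  · rw [lp.coeFn_smul, Pi.smul_apply, Pi.smul_apply, ← hu.1]
  · rw [lp.coeFn_smul, momentFunctional_smul]
    exact mul_nonneg hc (hu.2 p hp)

lemma add_mem_momentCone {δ : ℝ} {u v : lp (fun _ : ℤ => ℝ) 2}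
    (hu : u ∈ momentCone δ) (hv : v ∈ momentCone δ) : u + v ∈ momentCone δ := by
  rw [mem_momentCone_iff] at *
  refine ⟨fun k => ?_, fun p hp => ?_⟩
  · rw [lp.coeFn_add, Pi.add_apply, Pi.add_apply, ← hu.1, ← hv.1]
  · rw [lp.coeFn_add, momentFunctional_add]
    exact add_nonneg (hu.2 p hp) (hv.2 p hp)

lemma convex_momentCone (δ : ℝ) : Convex ℝ (momentCone δ) := fun _ hu _ hv _ _ ha hb _ =>
  add_mem_momentCone (smul_mem_momentCone ha hu) (smul_mem_momentCone hb hv)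

lemma isClosed_momentCone (δ : ℝ) : IsClosed (momentCone δ) := by
  have hc : Continuous fun (u : lp (fun _ : ℤ => ℝ) 2) => (u : ℤ → ℝ) :=
    lp.uniformContinuous_coe.continuous
  have : momentCone δ = (⋂ k : ℤ, {u | u k = u k.natAbs}) ∩
      ⋂ (p : Polynomial ℝ) (_ : ∀ x ∈ Icc (-1 + δ) (1 - δ), 0 ≤ p.eval x),
        {u : lp (fun _ : ℤ => ℝ) 2 | 0 ≤ momentFunctional u p} := by
    ext u
    simp only [mem_momentCone_iff, mem_inter_iff, mem_iInter]
    rfl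
  rw [this]
  refine (isClosed_iInter fun k => ?_).inter (isClosed_iInter fun p => isClosed_iInter fun _ => ?_)
  · exact isClosed_eq ((continuous_apply k).comp hc) ((continuous_apply _).comp hc)
  · exact isClosed_le continuous_const ((continuous_momentFunctional p).comp hc)

lemma inner_lp_eq_tsum (u v : lp (fun _ : ℤ => ℝ) 2) : inner ℝ u v = ∑' k, u k * v k := by
  rw [lp.inner_eq_tsum]
  exact tsum_congr fun k => by simp [mul_comm]

lemma summable_mul_lp (u v : lp (fun _ : ℤ => ℝ) 2) : Summable fun k => u k * v k := by
  refine (lp.summable_inner (𝕜 := ℝ) u v).congr fun k => by simp [mul_comm]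

lemma sqDist_eq_norm_sq (u v : lp (fun _ : ℤ => ℝ) 2) : sqDist u v = ‖u - v‖ ^ 2 := by
  rw [← real_inner_self_eq_norm_sq, inner_lp_eq_tsum]
  exact tsum_congr fun k => by simp [sq]

lemma isMomentLSE_iff {δ : ℝ} {r p : lp (fun _ : ℤ => ℝ) 2} :
    IsMomentLSE δ r p ↔ p ∈ momentCone δ ∧ ∀ m ∈ momentCone δ, inner ℝ (r - p) (m - p) ≤ 0 := by
  refine and_congr_right fun (hp : p ∈ momentCone δ) => ?_
  have hne : Nonempty (momentCone δ) := ⟨⟨p, hp⟩⟩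
  have hbdd : BddBelow (range fun w : momentCone δ => ‖r - w‖) :=
    ⟨0, by rintro _ ⟨w, rfl⟩; positivity⟩
  rw [← norm_eq_iInf_iff_real_inner_le_zero (convex_momentCone δ) hp]
  constructor
  · intro h
    refine le_antisymm (le_ciInf fun w => ?_) (ciInf_le hbdd ⟨p, hp⟩)
    have := h w w.2
    rw [sqDist_eq_norm_sq, sqDist_eq_norm_sq] at this
    exact le_of_sq_le_sq this (norm_nonneg _)
  · intro h m hm
    have : ‖r - p‖ ≤ ‖r - (⟨m, hm.2⟩ : lp (fun _ : ℤ => ℝ) 2)‖ :=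
      h.trans_le (ciInf_le hbdd ⟨⟨m, hm.2⟩, hm⟩)
    have := pow_le_pow_left₀ (norm_nonneg _) this 2
    rwa [← sqDist_eq_norm_sq, ← sqDist_eq_norm_sq] at this

/-- Existence and uniqueness of the projection. -/
lemma existsUnique_isMomentLSE (δ : ℝ) {r : ℤ → ℝ} (hr : Memℓp r 2) :
    ∃! p, IsMomentLSE δ r p := by
  obtain ⟨r, rfl⟩ := exists_lp_eq hr
  obtain ⟨p, hp, hmin⟩ := exists_norm_eq_iInf_of_complete_convex ⟨0, zero_mem_momentCone δ⟩
    (isClosed_momentCone δ).isComplete (convex_momentCone δ) r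
  rw [norm_eq_iInf_iff_real_inner_le_zero (convex_momentCone δ) hp] at hmin
  refine ⟨p, isMomentLSE_iff.2 ⟨hp, hmin⟩, fun q hq => ?_⟩
  have hq2 : Memℓp q 2 := hq.1.2
  obtain ⟨q, rfl⟩ := exists_lp_eq hq2
  obtain ⟨hqK, hq⟩ := isMomentLSE_iff.1 hq
  have h1 := hmin q hqK
  have h2 := hq p hp
  -- Each minimizer is tested against the other; the sum of the two inequalities is `‖q - p‖² ≤ 0`.
  have h3 : inner ℝ (q - p) (q - p) = inner ℝ (r - p) (q - p) + inner ℝ (r - q) (p - q) := by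
    simp only [inner_sub_left, inner_sub_right, real_inner_comm]
    ring
  have h4 : inner ℝ (q - p) (q - p) = (0 : ℝ) := le_antisymm (by linarith) real_inner_self_nonneg
  rw [sub_eq_zero.1 (inner_self_eq_zero.1 h4)]

lemma isMomentLSE_momentLSE (δ : ℝ) {r : ℤ → ℝ} (hr : Memℓp r 2) :
    IsMomentLSE δ r (momentLSE δ r) :=
  Classical.epsilon_spec (existsUnique_isMomentLSE δ hr).exists

/-- The variational inequality of the projection, tested against a moment sequence. -/
lemma IsMomentLSE.sqDist_le {δ : ℝ} {r p γ : ℤ → ℝ} (hr : Memℓp r 2) (hp : IsMomentLSE δ r p)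
    (hγ : γ ∈ momentSet δ) : sqDist γ p ≤ ∑' k, (γ k - r k) * (γ k - p k) := by
  have hp2 := hp.1.2
  have hγ2 := hγ.2
  obtain ⟨r, rfl⟩ := exists_lp_eq hr
  obtain ⟨p, rfl⟩ := exists_lp_eq hp2
  obtain ⟨γ, rfl⟩ := exists_lp_eq hγ2
  have h := (isMomentLSE_iff.1 hp).2 γ hγ
  have : inner ℝ (γ - p) (γ - p) = inner ℝ (γ - r) (γ - p) + inner ℝ (r - p) (γ - p) := by
    rw [← inner_add_left]; simp
  have h2 : (∑' k, (γ k - r k) * (γ k - p k)) = inner ℝ (γ - r) (γ - p) := by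
    rw [inner_lp_eq_tsum]; simp
  rw [sqDist_eq_norm_sq, ← real_inner_self_eq_norm_sq, h2]
  linarith

/-- The projection is orthogonal to its residual. -/
lemma IsMomentLSE.tsum_sq_eq {δ : ℝ} {r p : ℤ → ℝ} (hr : Memℓp r 2) (hp : IsMomentLSE δ r p) :
    Summable (fun k => p k * p k) ∧ Summable (fun k => r k * p k) ∧
      ∑' k, p k * p k = ∑' k, r k * p k := by
  have hp2 := hp.1.2
  obtain ⟨r, rfl⟩ := exists_lp_eq hr
  obtain ⟨p, rfl⟩ := exists_lp_eq hp2
  refine ⟨summable_mul_lp _ _, summable_mul_lp _ _, ?_⟩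
  obtain ⟨hpK, h⟩ := isMomentLSE_iff.1 hp
  -- The cone points `0` and `2p` give opposite signs for `⟨r - p, p⟩`.
  have h0 := h 0 (zero_mem_momentCone δ)
  have h2 := h _ (add_mem_momentCone hpK hpK)
  rw [← inner_lp_eq_tsum, ← inner_lp_eq_tsum]
  simp only [inner_sub_left, inner_sub_right, inner_add_right, inner_zero_right] at h0 h2
  linarith

/-- A bound on the mass of the measure representing the projection. -/
lemma IsMomentLSE.zero_le {δ : ℝ} (hδ : 0 < δ) {r p : ℤ → ℝ} (hr : Memℓp r 2)
    (hpeak : ∀ k, |r k| ≤ r 0) (hp : IsMomentLSE δ r p) :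
    p 0 ≤ r 0 * ∑' k : ℤ, max (1 - δ) 0 ^ k.natAbs := by
  obtain ⟨F, hF⟩ := hp.1.1
  obtain ⟨hs1, hs2, heq⟩ := hp.tsum_sq_eq hr
  have hsum := summable_pow_natAbs (le_max_right (1 - δ) 0) (max_lt (by linarith) one_pos)
  have hp0 : 0 ≤ p 0 := by rw [hF.zero_eq]; positivity
  have hr0 : 0 ≤ r 0 := (abs_nonneg _).trans (hpeak 0)
  -- With `C` the geometric sum, `p(0)² ≤ ⟨p, p⟩ = ⟨r, p⟩ ≤ r(0) p(0) C`; then one factor `p(0)` is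
  -- cancelled.
  have h1 : p 0 * p 0 ≤ ∑' k, p k * p k := hs1.le_tsum 0 fun k _ => mul_self_nonneg _
  have h2 : ∑' k, r k * p k ≤ r 0 * p 0 * ∑' k : ℤ, max (1 - δ) 0 ^ k.natAbs := by
    rw [← tsum_mul_left]
    refine hs2.tsum_le_tsum (fun k => ?_) (hsum.mul_left _)
    calc r k * p k ≤ |r k| * |p k| := by rw [← abs_mul]; exact le_abs_self _
      _ ≤ r 0 * (p 0 * max (1 - δ) 0 ^ k.natAbs) :=
        mul_le_mul (hpeak k) (hF.abs_le k) (abs_nonneg _) hr0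
      _ = _ := by ring
  have hC : 0 ≤ ∑' k : ℤ, max (1 - δ) 0 ^ k.natAbs := tsum_nonneg fun k => by positivity
  rcases hp0.eq_or_lt with h | h
  · rw [← h]; positivity
  · refine le_of_mul_le_mul_right ?_ h
    calc p 0 * p 0 ≤ _ := h1.trans (heq.trans_le h2)
      _ = _ := by ring

/-! ### Deterministic consistency -/

/-- Consistency of the projection of sequences converging pointwise to a moment sequence. -/
lemma tendsto_sqDist_momentLSE {δ : ℝ} (hδ : 0 < δ) {γ : ℤ → ℝ} (hγ : γ ∈ momentSet δ)
    {r : ℕ → ℤ → ℝ} (hr : ∀ᶠ M in atTop, Memℓp (r M) 2)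
    (hpeak : ∀ᶠ M in atTop, ∀ k, |r M k| ≤ r M 0)
    (hlim : ∀ k, Tendsto (fun M => r M k) atTop (𝓝 (γ k))) :
    Tendsto (fun M => sqDist γ (momentLSE δ (r M))) atTop (𝓝 0) := by
  obtain ⟨F, hF⟩ := hγ.1
  set ρ := max (1 - δ) 0 with hρ
  have hρ0 : 0 ≤ ρ := le_max_right _ _
  have hρ1 : ρ < 1 := max_lt (by linarith) one_pos
  have hsum := summable_pow_natAbs hρ0 hρ1
  set C := ∑' k : ℤ, ρ ^ k.natAbs with hC
  have hC0 : 0 ≤ C := tsum_nonneg fun k => by positivity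
  have hγ0 : 0 ≤ γ 0 := by rw [hF.zero_eq]; positivity
  have hγb : ∀ k, |γ k| ≤ γ 0 := fun k => (hF.abs_le k).trans
    (mul_le_of_le_one_right hγ0 (pow_le_one₀ hρ0 hρ1.le))
  have hr0 : ∀ᶠ M in atTop, r M 0 ≤ γ 0 + 1 :=
    (hlim 0).eventually_le_const (by linarith)
  -- Eventually bounds `γ(0)` plus the mass of the projection, hence `|γ k - p k| ≤ B * ρ ^
  -- k.natAbs` uniformly in `M`.
  set B := γ 0 + (γ 0 + 1) * C with hB
  have hdiff : ∀ᶠ M in atTop, ∀ k,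
      ‖|γ k - r M k| * (B * ρ ^ k.natAbs)‖ ≤ (2 * γ 0 + 1) * (B * ρ ^ k.natAbs) := by
    filter_upwards [hpeak, hr0] with M h1 h2 k
    rw [Real.norm_eq_abs, abs_mul, abs_abs, abs_of_nonneg (by positivity : 0 ≤ B * ρ ^ k.natAbs)]
    refine mul_le_mul_of_nonneg_right ?_ (by positivity)
    calc |γ k - r M k| ≤ |γ k| + |r M k| := abs_sub _ _
      _ ≤ _ := by linarith [hγb k, h1 k]
  have hmaj : Summable fun k : ℤ => (2 * γ 0 + 1) * (B * ρ ^ k.natAbs) :=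
    (hsum.mul_left B).mul_left _
  have hlim0 : Tendsto (fun M => ∑' k : ℤ, |γ k - r M k| * (B * ρ ^ k.natAbs)) atTop (𝓝 0) := by
    have := tendsto_tsum_of_dominated_convergence (𝓕 := atTop)
      (f := fun M k => |γ k - r M k| * (B * ρ ^ k.natAbs)) (g := fun _ : ℤ => (0 : ℝ)) hmaj
      (fun k => by
        have h : Tendsto (fun M => γ k - r M k) atTop (𝓝 (γ k - γ k)) :=
          tendsto_const_nhds.sub (hlim k)
        simpa using h.abs.mul_const (B * ρ ^ k.natAbs)) hdiff
    simpa using this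
  refine tendsto_of_tendsto_of_tendsto_of_le_of_le' tendsto_const_nhds hlim0
    (Eventually.of_forall fun M => tsum_nonneg fun k => sq_nonneg _) ?_
  filter_upwards [hr, hpeak, hr0, hdiff] with M hM hMpeak hM0 hMdiff
  have hp := isMomentLSE_momentLSE δ hM
  obtain ⟨G, hG⟩ := hp.1.1
  have hp0 := hp.zero_le hδ hM hMpeak
  have hpb : momentLSE δ (r M) 0 ≤ (γ 0 + 1) * C :=
    hp0.trans (mul_le_mul_of_nonneg_right hM0 hC0)
  have hterm : ∀ k, |(γ k - r M k) * (γ k - momentLSE δ (r M) k)| ≤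
      |γ k - r M k| * (B * ρ ^ k.natAbs) := fun k => by
    rw [abs_mul]
    refine mul_le_mul_of_nonneg_left ?_ (abs_nonneg _)
    calc _ ≤ |γ k| + |momentLSE δ (r M) k| := abs_sub _ _
      _ ≤ γ 0 * ρ ^ k.natAbs + momentLSE δ (r M) 0 * ρ ^ k.natAbs :=
        add_le_add (hF.abs_le k) (hG.abs_le k)
      _ ≤ γ 0 * ρ ^ k.natAbs + (γ 0 + 1) * C * ρ ^ k.natAbs := by gcongr
      _ = _ := by rw [hB]; ring
  have hs : Summable fun k : ℤ => |γ k - r M k| * (B * ρ ^ k.natAbs) :=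
    hmaj.of_norm_bounded hMdiff
  refine (hp.sqDist_le hM hγ).trans ?_
  exact (hs.of_norm_bounded hterm).tsum_le_tsum (fun k => (le_abs_self _).trans (hterm k)) hs

/-! ### Autocovariances as moments of a self-adjoint contraction -/

/-- The quadratic form of a self-adjoint contraction is positive on polynomials that are nonnegative
on `[-1, 1]`. -/
lemma momentFunctional_inner_pow_nonneg {H : Type*} [NormedAddCommGroup H] [InnerProductSpace ℂ H]
    [CompleteSpace H] {T : H →L[ℂ] H} (hT : IsSelfAdjoint T) (hT1 : ‖T‖ ≤ 1) (v : H)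
    {p : Polynomial ℝ} (hp : ∀ x ∈ Icc (-1 : ℝ) 1, 0 ≤ p.eval x) :
    0 ≤ momentFunctional (fun k => (inner ℂ v ((T ^ k.natAbs) v)).re) p := by
  have hspec : ∀ x ∈ spectrum ℝ T, x ∈ Icc (-1 : ℝ) 1 := fun x hx => by
    have h1 : ((x : ℂ)) ∈ spectrum ℂ T := by simpa using spectrum.algebraMap_mem ℂ hx
    have h2 := (spectrum.norm_le_norm_mul_of_mem h1).trans
      (mul_le_mul hT1 ContinuousLinearMap.norm_id_le (norm_nonneg _) zero_le_one)
    rw [Complex.norm_real, mul_one] at h2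
    exact abs_le.1 h2
  -- The spectrum lies in `[-1, 1]`, so functional calculus makes `p(T)` a positive operator.
  have h : 0 ≤ Polynomial.aeval T p := by
    rw [← cfc_polynomial p T hT]
    exact cfc_nonneg fun x hx => hp x (hspec x hx)
  have h2 := (ContinuousLinearMap.nonneg_iff_isPositive _).1 h |>.re_inner_nonneg_right v
  rw [Polynomial.aeval_eq_sum_range] at h2
  rw [momentFunctional_apply, Polynomial.sum_over_range _ (by simp)]
  convert h2 using 1
  simp only [_root_.sum_apply, inner_sum, map_sum]
  refine Finset.sum_congr rfl fun n _ => ?_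
  rw [_root_.smul_apply, ← Complex.coe_smul, inner_smul_right]
  simp [mul_comm]

section Operator

variable {S : Type*} [MeasurableSpace S] {π : Measure S} [IsProbabilityMeasure π]
  {κ : Kernel S S} [IsMarkovKernel κ]

lemma measurePreserving_fst_compProd (κ : Kernel S S) [IsMarkovKernel κ] (π : Measure S)
    [IsProbabilityMeasure π] : MeasurePreserving Prod.fst (π ⊗ₘ κ) π :=
  ⟨measurable_fst, Measure.fst_compProd π κ⟩

lemma measurePreserving_snd_compProd (h : κ.Invariant π) :
    MeasurePreserving Prod.snd (π ⊗ₘ κ) π :=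
  ⟨measurable_snd, (Measure.snd_compProd π κ).trans h⟩

/-- The operator `f ↦ ∫ f(y) κ(x, dy)` on `L²(π)`, for an invariant measure `π`. -/
noncomputable def markovOp (h : κ.Invariant π) : Lp ℂ 2 π →L[ℂ] Lp ℂ 2 π :=
  -- Conditional expectation of `f(y)` given `x` under `π ⊗ₘ κ`, written with two isometric
  -- pullbacks: independence of representatives and the norm bound come for free.
  ContinuousLinearMap.adjoint (Lp.compMeasurePreservingₗᵢ ℂ Prod.fst
      (measurePreserving_fst_compProd κ π)).toContinuousLinearMap ∘L
    (Lp.compMeasurePreservingₗᵢ ℂ Prod.snd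
      (measurePreserving_snd_compProd h)).toContinuousLinearMap

lemma norm_markovOp_le (h : κ.Invariant π) : ‖markovOp h‖ ≤ 1 := by
  refine (ContinuousLinearMap.opNorm_comp_le _ _).trans ?_
  rw [LinearIsometryEquiv.norm_map]
  exact mul_le_one₀ (LinearIsometry.norm_toContinuousLinearMap_le _) (norm_nonneg _)
    (LinearIsometry.norm_toContinuousLinearMap_le _)

lemma inner_markovOp_eq (h : κ.Invariant π) (u v : Lp ℂ 2 π) :
    inner ℂ u (markovOp h v) =
      inner ℂ (Lp.compMeasurePreserving Prod.fst (measurePreserving_fst_compProd κ π) u)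
        (Lp.compMeasurePreserving Prod.snd (measurePreserving_snd_compProd h) v) := by
  rw [markovOp, ContinuousLinearMap.comp_apply, ContinuousLinearMap.adjoint_inner_right]
  rfl

lemma inner_markovOp (h : κ.Invariant π) (u v : Lp ℂ 2 π) :
    inner ℂ u (markovOp h v) = ∫ z, inner ℂ (u z.1) (v z.2) ∂(π ⊗ₘ κ) := by
  rw [inner_markovOp_eq, L2.inner_def]
  refine integral_congr_ae ?_
  filter_upwards [Lp.coeFn_compMeasurePreserving u (measurePreserving_fst_compProd κ π),
    Lp.coeFn_compMeasurePreserving v (measurePreserving_snd_compProd h)] with z h1 h2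
  rw [h1, h2]
  rfl

/-- Reversibility says that `π ⊗ₘ κ` is invariant under swapping coordinates, and the form `⟨u, Tv⟩`
is an integral against it. -/
lemma isSelfAdjoint_markovOp (hrev : κ.IsReversible π) : IsSelfAdjoint (markovOp hrev.invariant) := by
  rw [ContinuousLinearMap.isSelfAdjoint_iff_isSymmetric]
  intro u v
  change inner ℂ (markovOp hrev.invariant u) v = inner ℂ u (markovOp hrev.invariant v)
  have hswap : (π ⊗ₘ κ).map MeasurableEquiv.prodComm = π ⊗ₘ κ := by
    refine Measure.ext_prod fun {s t} hs ht => ?_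
    rw [MeasurableEquiv.map_apply, Measure.compProd_apply_prod hs ht]
    have : (MeasurableEquiv.prodComm : S × S ≃ᵐ S × S) ⁻¹' s ×ˢ t = t ×ˢ s := by
      ext z; exact and_comm
    rw [this, Measure.compProd_apply_prod ht hs]
    exact hrev ht hs
  rw [← inner_conj_symm, inner_markovOp, inner_markovOp, ← integral_conj, ← hswap,
    integral_map_equiv, hswap]
  refine integral_congr_ae (Eventually.of_forall fun z => ?_)
  exact inner_conj_symm _ _

lemma integrable_snd_compProd (h : κ.Invariant π) (u : Lp ℂ 2 π) :
    Integrable (fun z => u z.2) (π ⊗ₘ κ) :=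
  (measurePreserving_snd_compProd h).integrable_comp_of_integrable
    ((Lp.memLp u).integrable one_le_two)

lemma ae_integrable (h : κ.Invariant π) (u : Lp ℂ 2 π) : ∀ᵐ x ∂π, Integrable u (κ x) :=
  ((Measure.integrable_compProd_iff (integrable_snd_compProd h u).1).1
    (integrable_snd_compProd h u)).1

/-- Both sides have the same integral over every measurable set, by testing the adjoint on
indicators. -/
lemma markovOp_ae_eq (h : κ.Invariant π) (u : Lp ℂ 2 π) :
    markovOp h u =ᵐ[π] fun x => ∫ y, u y ∂(κ x) := by
  have hu := integrable_snd_compProd h u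
  refine ae_eq_of_forall_setIntegral_eq_of_sigmaFinite
    (fun s _ _ => ((Lp.memLp _).integrable one_le_two).integrableOn)
    (fun s _ _ => (Integrable.integral_compProd (κ := Kernel.const Unit π)
      (η := Kernel.prodMkLeft Unit κ) (a := ()) hu).integrableOn) fun s hs hs' => ?_
  rw [← L2.inner_indicatorConstLp_one (𝕜 := ℂ) hs hs'.ne, inner_markovOp_eq,
    Lp.indicatorConstLp_compMeasurePreserving, L2.inner_indicatorConstLp_one]
  have h1 : ∫ z in Prod.fst ⁻¹' s,
      (Lp.compMeasurePreserving Prod.snd (measurePreserving_snd_compProd h) u) z ∂(π ⊗ₘ κ) =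
      ∫ z in s ×ˢ univ, u z.2 ∂(π ⊗ₘ κ) := by
    rw [prod_univ]
    exact integral_congr_ae (ae_restrict_of_ae (Lp.coeFn_compMeasurePreserving u _))
  rw [h1, Measure.setIntegral_compProd hs MeasurableSet.univ hu.integrableOn]
  simp

instance isMarkovKernel_pow (Q : Kernel S S) [IsMarkovKernel Q] (n : ℕ) :
    IsMarkovKernel (Q ^ n) := by
  induction n with
  | zero => exact inferInstanceAs (IsMarkovKernel Kernel.id)
  | succ n ih => exact inferInstanceAs (IsMarkovKernel ((Q ^ n) ∘ₖ Q))

omit [IsProbabilityMeasure π] in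
lemma invariant_pow {Q : Kernel S S} [IsMarkovKernel Q] (h : Q.Invariant π) (n : ℕ) :
    (Q ^ n).Invariant π := by
  induction n with
  | zero => exact Measure.id_comp
  | succ n ih => exact ih.comp h

lemma markovOp_pow {Q : Kernel S S} [IsMarkovKernel Q] (h : Q.Invariant π) (n : ℕ) :
    markovOp (invariant_pow h n) = markovOp h ^ n := by
  induction n with
  | zero =>
    ext1 u
    refine Lp.ext ((markovOp_ae_eq _ u).trans (Eventually.of_forall fun x => ?_))
    change ∫ y, u y ∂(Kernel.id x) = u x
    rw [Kernel.id_apply, integral_dirac' _ _ (Lp.stronglyMeasurable u)]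
  | succ n ih =>
    ext1 u
    rw [_root_.pow_succ' (markovOp h), ← ih, mul_apply_eq_comp]
    refine Lp.ext ?_
    -- By invariance a `π`-null set is `Q x`-null for almost every `x`, so the almost sure formula
    -- can be integrated against `Q x`.
    have h1 : ∀ᵐ x ∂π, ∀ᵐ y ∂(Q x), markovOp (invariant_pow h n) u y = ∫ z, u z ∂((Q ^ n) y) := by
      refine Measure.ae_ae_of_ae_comp ?_
      rw [h.def]
      exact markovOp_ae_eq _ u
    filter_upwards [markovOp_ae_eq (invariant_pow h (n + 1)) u,
      markovOp_ae_eq h (markovOp (invariant_pow h n) u), h1,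
      ae_integrable (invariant_pow h (n + 1)) u] with x hx1 hx2 hx3 hx4
    rw [hx1, hx2, integral_congr_ae hx3]
    exact Kernel.integral_comp hx4

/-- Both marginals of `π ⊗ₘ Q^|k|` are `π`, so one centring of `g` serves every lag. -/
lemma autocov_eq_inner {Q : Kernel S S} [IsMarkovKernel Q] (h : Q.Invariant π) {g : S → ℝ}
    (hg : MemLp g 2 π) : ∃ v : Lp ℂ 2 π, ∀ k : ℤ,
      autocov Q π g k = (inner ℂ v ((markovOp h ^ k.natAbs) v)).re := by
  have hv : MemLp (fun x => ((g x - ∫ y, g y ∂π : ℝ) : ℂ)) 2 π :=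
    (hg.sub (memLp_const _)).ofReal
  refine ⟨hv.toLp _, fun k => ?_⟩
  have hfst := measurePreserving_fst_compProd (Q ^ k.natAbs) π
  have hsnd := measurePreserving_snd_compProd (invariant_pow h k.natAbs)
  have e1 : ∫ z, g z.1 ∂(π ⊗ₘ (Q ^ k.natAbs)) = ∫ y, g y ∂π := by
    have := integral_map (μ := π ⊗ₘ (Q ^ k.natAbs)) hfst.aemeasurable (f := g)
      (by rw [hfst.map_eq]; exact hg.1)
    rwa [hfst.map_eq, eq_comm] at this
  have e2 : ∫ z, g z.2 ∂(π ⊗ₘ (Q ^ k.natAbs)) = ∫ y, g y ∂π := by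
    have := integral_map (μ := π ⊗ₘ (Q ^ k.natAbs)) hsnd.aemeasurable (f := g)
      (by rw [hsnd.map_eq]; exact hg.1)
    rwa [hsnd.map_eq, eq_comm] at this
  rw [← markovOp_pow, inner_markovOp, autocov, covariance, e1, e2]
  have h3 : ∀ᵐ z ∂(π ⊗ₘ (Q ^ k.natAbs)), inner ℂ (hv.toLp _ z.1) (hv.toLp _ z.2) =
      (((g z.1 - ∫ y, g y ∂π) * (g z.2 - ∫ y, g y ∂π) : ℝ) : ℂ) := by
    filter_upwards [hfst.quasiMeasurePreserving.ae hv.coeFn_toLp,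
      hsnd.quasiMeasurePreserving.ae hv.coeFn_toLp] with z h1 h2
    rw [h1, h2]
    simp [mul_comm]
  rw [integral_congr_ae h3, integral_complex_ofReal, Complex.ofReal_re]

lemma exists_representsOn_autocov {Q : Kernel S S} [IsMarkovKernel Q] (hrev : Q.IsReversible π)
    {g : S → ℝ} (hg : MemLp g 2 π) : ∃ F, RepresentsOn (-1) 1 F (autocov Q π g) := by
  obtain ⟨v, hv⟩ := autocov_eq_inner hrev.invariant hg
  rw [exists_representsOn_iff, funext hv]
  exact ⟨fun k => by simp only [Int.natAbs_natCast], fun p hp => momentFunctional_inner_pow_nonneg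
    (isSelfAdjoint_markovOp hrev) (norm_markovOp_le _) v hp⟩

end Operator

end MomentLS

theorem mainTheorem1
    {S : Type*} [TopologicalSpace S] [PolishSpace S] [MeasurableSpace S] [BorelSpace S]
    (Q : Kernel S S) [IsMarkovKernel Q]
    (π : Measure S) [IsProbabilityMeasure π] (hrev : Q.IsReversible π)
    (ψ : Measure S) [IsProbabilityMeasure ψ] (hirr : Kernel.IsIrreducible ψ Q)
    (hdrift : MomentLS.GeometricDrift Q) (haper : MomentLS.IsAperiodic ψ Q)
    {Ω : Type*} [MeasurableSpace Ω] (P : Measure Ω) [IsProbabilityMeasure P]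
    (X : ℕ → Ω → S) (hX : MomentLS.IsMarkovChain P Q X)
    (g : S → ℝ) (hg : MemLp g 2 π) :
    (∃! F : Measure ℝ, MomentLS.IsRepresentingMeasure F (MomentLS.autocov Q π g)) ∧
    ∀ F : Measure ℝ, MomentLS.IsRepresentingMeasure F (MomentLS.autocov Q π g) →
      ∀ δ : ℝ, 0 < δ → F (Icc (-1 + δ) (1 - δ))ᶜ = 0 →
        ∀ r : (M : ℕ) → (Fin M → S) → ℤ → ℝ,
          MomentLS.IsInitialEstimator P X (MomentLS.autocov Q π g) r →
          Memℓp (MomentLS.autocov Q π g) 2 ∧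
          (∀ M, 1 ≤ M → ∀ x : Fin M → S,
            Memℓp (r M x) 2 ∧ ∃! p, MomentLS.IsMomentLSE δ (r M x) p) ∧
          ∀ᵐ ω ∂P, Tendsto
            (fun M => MomentLS.sqDist (MomentLS.autocov Q π g)
              (MomentLS.momentLSE δ (r M (fun i => X i ω)))) atTop (𝓝 0) := by
  obtain ⟨F₀, hF₀⟩ := MomentLS.exists_representsOn_autocov hrev hg
  refine ⟨⟨F₀, ⟨-1, 1, hF₀⟩, fun G hG => hG.unique ⟨-1, 1, hF₀⟩⟩, ?_⟩
  rintro F ⟨a, b, hF⟩ δ hδ hFδ r hr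
  have hFδ' : MomentLS.RepresentsOn (-1 + δ) (1 - δ) F (MomentLS.autocov Q π g) :=
    ⟨hF.1, hFδ, hF.2.2⟩
  have hγ := hFδ'.memℓp hδ
  have hr2 : ∀ M, 1 ≤ M → ∀ x : Fin M → S, Memℓp (r M x) 2 := fun M hM x =>
    (hr.finite_support M hM x).elim fun _ hn =>
      MomentLS.memℓp_two_of_finite_support (hr.even M hM x) hn
  refine ⟨hγ, fun M hM x => ⟨hr2 M hM x, MomentLS.existsUnique_isMomentLSE δ (hr2 M hM x)⟩, ?_⟩
  -- There are countably many lags, so one null set serves them all.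
  filter_upwards [ae_all_iff.2 hr.tendsto] with ω hω
  exact MomentLS.tendsto_sqDist_momentLSE hδ ⟨⟨F, hFδ'⟩, hγ⟩
    ((eventually_ge_atTop 1).mono fun M hM => hr2 M hM _)
    ((eventually_ge_atTop 1).mono fun M hM => hr.peak M hM _) hω
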